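/- Let $C([0,1])$ carry the supremum norm $\|\cdot\|_\infty$, and for $h\in C([0,1])$ put $$F(h)(x)=\sum_{k\ge 1}2^{-k}\left(h\left(\frac{x}{x+2^k}\right)-h\left(\frac{1}{1+2^kx}\right)\right),\qquad x\in[0,1].$$ Let $S\subset C([0,1])$ be the set of all sums $\sum_{i\in\mathbb N}\varepsilon_i m_i$ with $\varepsilon_i\in\{1,-1\}$ and $m_i(x)=\frac{a_ix+b_i}{c_ix+d_i}$, where $a_i,b_i\ge 0$, $c_i,d_i>0$, $a_id_i-b_ic_i\ne 0$, such that $\varepsilon_i\cdot\operatorname{sgn}(a_id_i-b_ic_i)<0$ for all $i$, $\sum_i\|m_i\|_\infty<\infty$ and $\sum_i\frac{|a_id_i-b_ic_i|}{c_id_i}<\infty$. Let $K_1$ be the set of all $g$ in the closure $\overline S$ of $S$ in $C([0,1])$ with $g(0)=1$ and $g(1)=0$. Let $B_2$ be the binary Euclidean operator on $L^1([0,1])$, $$B_2(f)(x)=\sum_{k\ge 1}\left[\left(\frac{1}{x+2^k}\right)^2 f\left(\frac{x}{x+2^k}\right)+\left(\frac{1}{1+2^kx}\right)^2 f\left(\frac{1}{1+2^kx}\right)\right].$$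 **Proposition.** The operator $B_2$ is a well-defined bounded linear operator on $L^1([0,1])$: for every $f\in L^1([0,1])$ the series above converges absolutely for almost every $x\in[0,1]$ and its sum is $B_2(f)$. Moreover $\|B_2(f)\|_1\le\|f\|_1$ for all $f\in L^1([0,1])$. For every $h\in K_1$, the functions $h$ and $F(h)$ are absolutely continuous on $[0,1]$, hence differentiable almost everywhere with derivatives in $L^1([0,1])$, and $$F(h)'=B_2(h')\quad\text{in } L^1([0,1]).$$ -/

import Mathlib

open MeasureTheory Set
open scoped ENNReal

noncomputable section

namespace BinaryEuclid

/-- The maps `x ↦ x / (x + 2 ^ k)` of `[0,1]` to itself. -/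
def mu (k : ℕ) : C(unitInterval, unitInterval) where
  toFun x := ⟨(x : ℝ) / (x + 2 ^ k), by
    have h0 : (0 : ℝ) ≤ x := x.2.1
    have h1 : (0 : ℝ) < 2 ^ k := by positivity
    exact ⟨by positivity, by rw [div_le_one (by positivity)]; linarith⟩⟩
  continuous_toFun := by
    refine Continuous.subtype_mk (Continuous.div (by fun_prop) (by fun_prop) ?_) _
    intro x
    have h0 : (0 : ℝ) ≤ x := x.2.1
    positivity

/-- The maps `x ↦ 1 / (1 + 2 ^ k * x)` of `[0,1]` to itself. -/
def nu (k : ℕ) : C(unitInterval, unitInterval) where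
  toFun x := ⟨1 / (1 + 2 ^ k * (x : ℝ)), by
    have h0 : (0 : ℝ) ≤ x := x.2.1
    have h1 : (0 : ℝ) ≤ 2 ^ k * (x : ℝ) := by positivity
    exact ⟨by positivity, by rw [div_le_one (by positivity)]; linarith⟩⟩
  continuous_toFun := by
    refine Continuous.subtype_mk (Continuous.div (by fun_prop) (by fun_prop) ?_) _
    intro x
    have h0 : (0 : ℝ) ≤ x := x.2.1
    positivity

/-- The operator `F(h)(x) = ∑_{k ≥ 1} 2⁻ᵏ (h(x/(x+2ᵏ)) - h(1/(1+2ᵏx)))` on `C([0,1])`.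
The summation index is shifted by one. -/
def F (h : C(unitInterval, ℝ)) : C(unitInterval, ℝ) where
  toFun x := ∑' k : ℕ, (1 / 2 : ℝ) ^ (k + 1) * (h (mu (k + 1) x) - h (nu (k + 1) x))
  continuous_toFun := by
    refine continuous_tsum (u := fun k : ℕ => (1 / 2 : ℝ) ^ (k + 1) * (‖h‖ + ‖h‖))
      (fun k => by fun_prop) ?_ ?_
    · exact ((summable_nat_add_iff 1).2 summable_geometric_two).mul_right _
    · intro k x
      rw [norm_mul, Real.norm_of_nonneg (by positivity)]
      gcongr
      exact (norm_sub_le _ _).trans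
        (add_le_add (h.norm_coe_le_norm _) (h.norm_coe_le_norm _))

/-- Coefficients of a Möbius function `x ↦ (a x + b) / (c x + d)` with
`a, b ≥ 0`, `c, d > 0`, `a d - b c ≠ 0`. -/
structure Moebius where
  a : ℝ
  b : ℝ
  c : ℝ
  d : ℝ
  a_nonneg : 0 ≤ a
  b_nonneg : 0 ≤ b
  c_pos : 0 < c
  d_pos : 0 < d
  det_ne_zero : a * d - b * c ≠ 0

/-- The determinant `a d - b c`. -/
def Moebius.det (m : Moebius) : ℝ := m.a * m.d - m.b * m.c

/-- The function `x ↦ (a x + b) / (c x + d)` on `[0,1]`. -/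
def Moebius.toMap (m : Moebius) : C(unitInterval, ℝ) where
  toFun x := (m.a * x + m.b) / (m.c * x + m.d)
  continuous_toFun := by
    refine Continuous.div (by fun_prop) (by fun_prop) ?_
    intro x
    have h0 : (0 : ℝ) ≤ x := x.2.1
    have := m.c_pos
    have := m.d_pos
    positivity

/-- The set `S` of all sums `∑ i, ε i * m i` of Möbius functions with signs `ε i = ±1`,
`ε i * sgn (m i) < 0`, `∑ i, ‖m i‖_∞ < ∞` and `∑ i, |a i * d i - b i * c i| / (c i * d i) < ∞`. -/
def S : Set C(unitInterval, ℝ) :=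
  {g | ∃ (ε : ℕ → ℝ) (m : ℕ → Moebius),
    (∀ i, ε i = 1 ∨ ε i = -1) ∧
    (∀ i, ε i * Real.sign (m i).det < 0) ∧
    Summable (fun i => ‖(m i).toMap‖) ∧
    Summable (fun i => |(m i).det| / ((m i).c * (m i).d)) ∧
    ∀ x, HasSum (fun i => ε i * (m i).toMap x) (g x)}

/-- `K₁`: the elements of the closure of `S` for the supremum norm with `g 0 = 1`, `g 1 = 0`. -/
def K1 : Set C(unitInterval, ℝ) := closure S ∩ {g | g 0 = 1 ∧ g 1 = 0}

/-- Lebesgue measure on `[0,1]`. -/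
abbrev leb : Measure ℝ := volume.restrict (Icc (0 : ℝ) 1)

/-- The Banach space `L¹([0,1])`. -/
abbrev L1 : Type := Lp ℝ 1 leb

/-- `g` is the derivative of `h` in `L¹([0,1])`: `h` is differentiable almost everywhere with
derivative `g`, and `h` is the integral of `g` (absolute continuity). The constant extension of
`h` to the line does not affect derivatives at interior points. -/
def HasL1Deriv (h : C(unitInterval, ℝ)) (g : L1) : Prop :=
  (∀ᵐ x ∂leb, HasDerivAt (IccExtend (zero_le_one' ℝ) h) (g x) x) ∧
    ∀ x : unitInterval, h x = h 0 + ∫ t in (0 : ℝ)..x, g t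

/-- The hypotheses under which `f ↦ w * (f ∘ φ)` is bounded on `L¹([0,1])` with norm at most `C`. -/
structure IsBoundedWeight (φ w : ℝ → ℝ) (C : ℝ) : Prop where
  meas_map : Measurable φ
  meas_weight : Measurable w
  const_nonneg : 0 ≤ C
  bound : ∀ g : ℝ → ℝ≥0∞,
    ∫⁻ x, ‖w x‖ₑ * g (φ x) ∂leb ≤ ENNReal.ofReal C * ∫⁻ x, g x ∂leb

lemma IsBoundedWeight.eLpNorm_le {φ w : ℝ → ℝ} {C : ℝ} (H : IsBoundedWeight φ w C)
    (f : ℝ → ℝ) :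
    eLpNorm (fun x => w x * f (φ x)) 1 leb ≤ ENNReal.ofReal C * eLpNorm f 1 leb := by
  simp only [eLpNorm_one_eq_lintegral_enorm, enorm_mul]
  exact H.bound fun x => ‖f x‖ₑ

lemma IsBoundedWeight.memLp {φ w : ℝ → ℝ} {C : ℝ} (H : IsBoundedWeight φ w C) (f : L1) :
    MemLp (fun x => w x * f (φ x)) 1 leb := by
  refine ⟨(H.meas_weight.mul
    ((Lp.stronglyMeasurable f).measurable.comp H.meas_map)).aestronglyMeasurable, ?_⟩
  exact (H.eLpNorm_le f).trans_lt (ENNReal.mul_lt_top ENNReal.ofReal_lt_top (Lp.eLpNorm_lt_top f))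

lemma IsBoundedWeight.ae_congr {φ w : ℝ → ℝ} {C : ℝ} (H : IsBoundedWeight φ w C)
    {f g : ℝ → ℝ} (hf : Measurable f) (hg : Measurable g) (h : f =ᵐ[leb] g) :
    (fun x => w x * f (φ x)) =ᵐ[leb] fun x => w x * g (φ x) := by
  have h0 : eLpNorm (f - g) 1 leb = 0 := by
    rw [eLpNorm_congr_ae (g := 0) (by filter_upwards [h] with x hx; simp [hx])]
    simp
  have h1 := H.eLpNorm_le (f - g)
  have hm : Measurable fun x => w x * (f - g) (φ x) :=
    H.meas_weight.mul ((hf.sub hg).comp H.meas_map)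
  rw [h0, mul_zero, nonpos_iff_eq_zero, eLpNorm_eq_zero_iff
    hm.aestronglyMeasurable one_ne_zero] at h1
  filter_upwards [h1] with x hx
  simp only [Pi.sub_apply, Pi.zero_apply, mul_sub] at hx
  linarith

/-- The bounded operator `f ↦ w * (f ∘ φ)` on `L¹([0,1])`. -/
def weightedComp {φ w : ℝ → ℝ} {C : ℝ} (H : IsBoundedWeight φ w C) : L1 →L[ℝ] L1 :=
  LinearMap.mkContinuous
    { toFun := fun f => (H.memLp f).toLp (fun x => w x * f (φ x))
      map_add' := fun f g => by
        rw [← MemLp.toLp_add]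
        refine MemLp.toLp_congr _ _ ?_
        refine (H.ae_congr (Lp.stronglyMeasurable _).measurable
          ((Lp.stronglyMeasurable f).measurable.add (Lp.stronglyMeasurable g).measurable)
          (Lp.coeFn_add f g)).trans (Filter.Eventually.of_forall fun x => ?_)
        simp only [Pi.add_apply, mul_add]
      map_smul' := fun r f => by
        rw [RingHom.id_apply, ← MemLp.toLp_const_smul]
        refine MemLp.toLp_congr _ _ ?_
        refine (H.ae_congr (Lp.stronglyMeasurable _).measurable
          ((Lp.stronglyMeasurable f).measurable.const_smul r)
          (Lp.coeFn_smul r f)).trans (Filter.Eventually.of_forall fun x => ?_)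
        simp only [Pi.smul_apply, smul_eq_mul]
        ring }
    C fun f => by
      simp only [LinearMap.coe_mk, AddHom.coe_mk]
      rw [Lp.norm_toLp, Lp.norm_def, ← ENNReal.toReal_ofReal H.const_nonneg,
        ← ENNReal.toReal_mul]
      exact ENNReal.toReal_mono
        (ENNReal.mul_lt_top ENNReal.ofReal_lt_top (Lp.eLpNorm_lt_top f)).ne (H.eLpNorm_le f)

/-- Change of variables. -/
lemma isBoundedWeight_of_deriv {φ φ' w : ℝ → ℝ} {C : ℝ} (hφ : Measurable φ) (hw : Measurable w)
    (hC : 0 ≤ C) (hd : ∀ x ∈ Icc (0 : ℝ) 1, HasDerivAt φ (φ' x) x)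
    (hi : InjOn φ (Icc 0 1)) (hm : MapsTo φ (Icc 0 1) (Icc 0 1))
    (hwφ : ∀ x ∈ Icc (0 : ℝ) 1, |w x| = C * |φ' x|) : IsBoundedWeight φ w C := by
  refine ⟨hφ, hw, hC, fun g => ?_⟩
  calc ∫⁻ x, ‖w x‖ₑ * g (φ x) ∂leb
      = ∫⁻ x in Icc 0 1, ENNReal.ofReal C * (ENNReal.ofReal |φ' x| * g (φ x)) := by
        refine setLIntegral_congr_fun measurableSet_Icc fun x hx => ?_
        rw [← mul_assoc, ← ENNReal.ofReal_mul hC, ← hwφ x hx, Real.enorm_eq_ofReal_abs]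
    _ = ENNReal.ofReal C * ∫⁻ x in Icc 0 1, ENNReal.ofReal |φ' x| * g (φ x) :=
        lintegral_const_mul' _ _ ENNReal.ofReal_ne_top
    _ = ENNReal.ofReal C * ∫⁻ x in φ '' Icc 0 1, g x := by
        rw [lintegral_image_eq_lintegral_abs_deriv_mul measurableSet_Icc
          (fun x hx => (hd x hx).hasDerivWithinAt) hi]
    _ ≤ ENNReal.ofReal C * ∫⁻ x, g x ∂leb := by
        gcongr
        exact Measure.restrict_mono hm.image_subset le_rfl

lemma isBoundedWeight_mu (k : ℕ) :
    IsBoundedWeight (fun x => x / (x + 2 ^ k)) (fun x => (1 / (x + 2 ^ k)) ^ 2)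
      ((1 / 2) ^ k) := by
  have hp : (0 : ℝ) < 2 ^ k := by positivity
  refine isBoundedWeight_of_deriv (φ' := fun x => 2 ^ k / (x + 2 ^ k) ^ 2)
    (by fun_prop) (by fun_prop) (by positivity) ?_ ?_ ?_ ?_
  · intro x hx
    have h0 : x + 2 ^ k ≠ 0 := by have := hx.1; positivity
    exact ((hasDerivAt_id' x).div ((hasDerivAt_id' x).add_const ((2 : ℝ) ^ k)) h0).congr_deriv
      (by ring)
  · intro x hx y hy h
    have h1 : x + 2 ^ k ≠ 0 := by have := hx.1; positivity
    have h2 : y + 2 ^ k ≠ 0 := by have := hy.1; positivity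
    simp only at h
    rw [div_eq_div_iff h1 h2] at h
    have : (x - y) * 2 ^ k = 0 := by linarith
    rcases mul_eq_zero.1 this with h | h
    · linarith
    · exact absurd h hp.ne'
  · intro x hx
    have := hx.1
    exact ⟨by positivity, by rw [div_le_one (by positivity)]; linarith⟩
  · intro x hx
    have := hx.1
    rw [abs_of_nonneg (by positivity), abs_of_nonneg (by positivity), div_pow,
      div_pow]
    simp only [one_pow]
    field_simp

lemma isBoundedWeight_nu (k : ℕ) :
    IsBoundedWeight (fun x => 1 / (1 + 2 ^ k * x)) (fun x => (1 / (1 + 2 ^ k * x)) ^ 2)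
      ((1 / 2) ^ k) := by
  have hp : (0 : ℝ) < 2 ^ k := by positivity
  refine isBoundedWeight_of_deriv (φ' := fun x => -(2 ^ k / (1 + 2 ^ k * x) ^ 2))
    (by fun_prop) (by fun_prop) (by positivity) ?_ ?_ ?_ ?_
  · intro x hx
    have h0 : 1 + 2 ^ k * x ≠ 0 := by have := hx.1; positivity
    exact ((hasDerivAt_const x (1 : ℝ)).div
      (((hasDerivAt_id' x).const_mul ((2 : ℝ) ^ k)).const_add 1) h0).congr_deriv (by ring)
  · intro x hx y hy h
    have h1 : 1 + 2 ^ k * x ≠ 0 := by have := hx.1; positivity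
    have h2 : 1 + 2 ^ k * y ≠ 0 := by have := hy.1; positivity
    simp only at h
    rw [div_eq_div_iff h1 h2] at h
    have : (x - y) * 2 ^ k = 0 := by linarith
    rcases mul_eq_zero.1 this with h | h
    · linarith
    · exact absurd h hp.ne'
  · intro x hx
    have : 0 ≤ 2 ^ k * x := by have := hx.1; positivity
    exact ⟨by positivity, by rw [div_le_one (by positivity)]; linarith⟩
  · intro x hx
    have := hx.1
    rw [abs_neg, abs_of_nonneg (by positivity), abs_of_nonneg (by positivity), div_pow,
      div_pow]
    simp only [one_pow]
    field_simp

/-- The `k`-th term of the binary Euclidean operator, for functions. -/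
def B2Term (k : ℕ) (f : ℝ → ℝ) (x : ℝ) : ℝ :=
  (1 / (x + 2 ^ k)) ^ 2 * f (x / (x + 2 ^ k)) +
    (1 / (1 + 2 ^ k * x)) ^ 2 * f (1 / (1 + 2 ^ k * x))

/-- The `k`-th term of the binary Euclidean operator, as a bounded operator on `L¹([0,1])`. -/
def B2TermL1 (k : ℕ) : L1 →L[ℝ] L1 :=
  weightedComp (isBoundedWeight_mu k) + weightedComp (isBoundedWeight_nu k)

lemma B2TermL1_coeFn (k : ℕ) (f : L1) : B2TermL1 k f =ᵐ[leb] B2Term k f := by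
  filter_upwards [Lp.coeFn_add (weightedComp (isBoundedWeight_mu k) f)
      (weightedComp (isBoundedWeight_nu k) f),
    ((isBoundedWeight_mu k).memLp f).coeFn_toLp, ((isBoundedWeight_nu k).memLp f).coeFn_toLp]
    with x h1 h2 h3
  refine h1.trans ?_
  rw [Pi.add_apply]
  exact congrArg₂ (· + ·) h2 h3

/-- The binary Euclidean operator `B₂ = ∑_{k ≥ 1} (k-th term)` on `L¹([0,1])`; the series converges
absolutely in operator norm. The summation index is shifted by one. -/
def B2 : L1 →L[ℝ] L1 := ∑' k : ℕ, B2TermL1 (k + 1)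

lemma summable_B2TermL1 : Summable fun k : ℕ => B2TermL1 (k + 1) := by
  refine Summable.of_norm_bounded
    (g := fun k : ℕ => (1 / 2 : ℝ) ^ (k + 1) + (1 / 2 : ℝ) ^ (k + 1)) ?_ fun k => ?_
  · have := (summable_nat_add_iff 1).2 summable_geometric_two
    exact this.add this
  · refine (norm_add_le _ _).trans (add_le_add ?_ ?_) <;>
      exact LinearMap.mkContinuous_norm_le _ (by positivity) _

end BinaryEuclid

end

open Filter Topology

namespace BinaryEuclid

/-! ### The operator `B₂` -/

/-! The maps `x/(x+2^k)` and `1/(1+2^k x)` send `[0,1]` onto two intervals meeting only at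
`1/(1+2^k)`, and the weights of `B2` are `2^{-k}` times the absolute values of their derivatives.
Change of variables thus bounds the `k`-th term by `2^{-k}` (`norm_B2TermL1_apply_le`), and these
bounds sum to `1`.

Substitution also integrates each term of `B2 h'` to the matching increment in `F h`
(`integral_B2Term`); L¹ convergence permits summation.

For absolute continuity on `K1`, each signed Möbius summand is decreasing and convex. A closed form
of this, `SlopeControlled`, passes to the closure of `S`. It makes `h` Lipschitz on every `[δ,1]`;
monotonicity makes `h'` integrable up to `0`, and continuity of `h` carries the fundamental theorem
of calculus to `0` (`SlopeControlled.exists_hasL1Deriv`). -/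

lemma lintegral_weight_comp_le {φ φ' w : ℝ → ℝ} {C : ℝ} {t : Set ℝ}
    (hC : 0 ≤ C) (hd : ∀ x ∈ Icc (0 : ℝ) 1, HasDerivAt φ (φ' x) x)
    (hi : InjOn φ (Icc 0 1)) (hm : MapsTo φ (Icc 0 1) t)
    (hwφ : ∀ x ∈ Icc (0 : ℝ) 1, |w x| = C * |φ' x|) (g : ℝ → ℝ≥0∞) :
    ∫⁻ x, ‖w x‖ₑ * g (φ x) ∂leb ≤ ENNReal.ofReal C * ∫⁻ x in t, g x := by
  calc ∫⁻ x, ‖w x‖ₑ * g (φ x) ∂leb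
      = ∫⁻ x in Icc 0 1, ENNReal.ofReal C * (ENNReal.ofReal |φ' x| * g (φ x)) := by
        refine setLIntegral_congr_fun measurableSet_Icc fun x hx => ?_
        rw [← mul_assoc, ← ENNReal.ofReal_mul hC, ← hwφ x hx, Real.enorm_eq_ofReal_abs]
    _ = ENNReal.ofReal C * ∫⁻ x in Icc 0 1, ENNReal.ofReal |φ' x| * g (φ x) :=
        lintegral_const_mul' _ _ ENNReal.ofReal_ne_top
    _ = ENNReal.ofReal C * ∫⁻ x in φ '' Icc 0 1, g x := by
        rw [lintegral_image_eq_lintegral_abs_deriv_mul measurableSet_Icc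
          (fun x hx => (hd x hx).hasDerivWithinAt) hi]
    _ ≤ ENNReal.ofReal C * ∫⁻ x in t, g x := by
        gcongr
        exact hm.image_subset

lemma hasDerivAt_mu (k : ℕ) {x : ℝ} (hx : 0 ≤ x) :
    HasDerivAt (fun x : ℝ => x / (x + 2 ^ k)) (2 ^ k / (x + 2 ^ k) ^ 2) x := by
  have h0 : x + 2 ^ k ≠ 0 := by positivity
  exact ((hasDerivAt_id' x).div ((hasDerivAt_id' x).add_const ((2 : ℝ) ^ k)) h0).congr_deriv
    (by ring)

lemma hasDerivAt_nu (k : ℕ) {x : ℝ} (hx : 0 ≤ x) :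
    HasDerivAt (fun x : ℝ => 1 / (1 + 2 ^ k * x)) (-(2 ^ k / (1 + 2 ^ k * x) ^ 2)) x := by
  have h0 : 1 + 2 ^ k * x ≠ 0 := by positivity
  exact ((hasDerivAt_const x (1 : ℝ)).div
    (((hasDerivAt_id' x).const_mul ((2 : ℝ) ^ k)).const_add 1) h0).congr_deriv (by ring)

/-- Keeping the image interval on the right, instead of all of `[0,1]`, avoids a factor 2 once both
branches are added. -/
lemma lintegral_mu_le (k : ℕ) (g : ℝ → ℝ≥0∞) :
    ∫⁻ x, ‖(1 / (x + 2 ^ k)) ^ 2‖ₑ * g (x / (x + 2 ^ k)) ∂leb ≤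
      ENNReal.ofReal ((1 / 2) ^ k) * ∫⁻ x in Icc 0 (1 / (1 + 2 ^ k)), g x := by
  have hp : (0 : ℝ) < 2 ^ k := by positivity
  refine lintegral_weight_comp_le (w := fun x => (1 / (x + 2 ^ k)) ^ 2) (by positivity)
    (fun x hx => hasDerivAt_mu k hx.1) ?_ ?_ ?_ g
  · intro x hx y hy h
    have h1 : x + 2 ^ k ≠ 0 := by have := hx.1; positivity
    have h2 : y + 2 ^ k ≠ 0 := by have := hy.1; positivity
    simp only at h
    rw [div_eq_div_iff h1 h2] at h
    have : (x - y) * 2 ^ k = 0 := by linarith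
    rcases mul_eq_zero.1 this with h | h
    · linarith
    · exact absurd h hp.ne'
  · intro x hx
    have := hx.1
    refine ⟨by positivity, ?_⟩
    rw [div_le_div_iff₀ (by positivity) (by positivity)]
    nlinarith [hx.2]
  · intro x hx
    have := hx.1
    rw [abs_of_nonneg (by positivity), abs_of_nonneg (by positivity), div_pow, div_pow]
    simp only [one_pow]
    field_simp

lemma lintegral_nu_le (k : ℕ) (g : ℝ → ℝ≥0∞) :
    ∫⁻ x, ‖(1 / (1 + 2 ^ k * x)) ^ 2‖ₑ * g (1 / (1 + 2 ^ k * x)) ∂leb ≤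
      ENNReal.ofReal ((1 / 2) ^ k) * ∫⁻ x in Icc (1 / (1 + 2 ^ k)) 1, g x := by
  have hp : (0 : ℝ) < 2 ^ k := by positivity
  refine lintegral_weight_comp_le (w := fun x => (1 / (1 + 2 ^ k * x)) ^ 2) (by positivity)
    (fun x hx => hasDerivAt_nu k hx.1) ?_ ?_ ?_ g
  · intro x hx y hy h
    have h1 : 1 + 2 ^ k * x ≠ 0 := by have := hx.1; positivity
    have h2 : 1 + 2 ^ k * y ≠ 0 := by have := hy.1; positivity
    simp only at h
    rw [div_eq_div_iff h1 h2] at h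
    have : (x - y) * 2 ^ k = 0 := by linarith
    rcases mul_eq_zero.1 this with h | h
    · linarith
    · exact absurd h hp.ne'
  · intro x hx
    have h0 : 0 ≤ 2 ^ k * x := by have := hx.1; positivity
    refine ⟨?_, by rw [div_le_one (by positivity)]; linarith⟩
    refine one_div_le_one_div_of_le (by positivity) ?_
    nlinarith [hx.2]
  · intro x hx
    have := hx.1
    rw [abs_neg, abs_of_nonneg (by positivity), abs_of_nonneg (by positivity), div_pow, div_pow]
    simp only [one_pow]
    field_simp

/-- The images of `[0,1]` under the two inverse branches overlap in a single point only. -/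
lemma norm_B2TermL1_apply_le (k : ℕ) (f : L1) : ‖B2TermL1 k f‖ ≤ (1 / 2) ^ k * ‖f‖ := by
  have hm1 : Measurable fun x : ℝ => (1 / (x + 2 ^ k)) ^ 2 * f (x / (x + 2 ^ k)) :=
    (isBoundedWeight_mu k).meas_weight.mul
      ((Lp.stronglyMeasurable f).measurable.comp (isBoundedWeight_mu k).meas_map)
  have hc0 : (0 : ℝ) ≤ 1 / (1 + 2 ^ k) := by positivity
  have hc1 : (1 : ℝ) / (1 + 2 ^ k) ≤ 1 := by
    rw [div_le_one (by positivity)]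
    have : (0 : ℝ) < 2 ^ k := by positivity
    linarith
  have key : eLpNorm (B2TermL1 k f) 1 leb ≤ ENNReal.ofReal ((1 / 2) ^ k) * eLpNorm f 1 leb := by
    rw [eLpNorm_congr_ae (B2TermL1_coeFn k f)]
    simp only [eLpNorm_one_eq_lintegral_enorm]
    calc ∫⁻ x, ‖B2Term k f x‖ₑ ∂leb
        ≤ ∫⁻ x, (‖(1 / (x + 2 ^ k)) ^ 2 * f (x / (x + 2 ^ k))‖ₑ +
            ‖(1 / (1 + 2 ^ k * x)) ^ 2 * f (1 / (1 + 2 ^ k * x))‖ₑ) ∂leb :=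
          lintegral_mono fun x => enorm_add_le _ _
      _ = ∫⁻ x, ‖(1 / (x + 2 ^ k)) ^ 2‖ₑ * ‖f (x / (x + 2 ^ k))‖ₑ ∂leb +
            ∫⁻ x, ‖(1 / (1 + 2 ^ k * x)) ^ 2‖ₑ * ‖f (1 / (1 + 2 ^ k * x))‖ₑ ∂leb := by
          rw [lintegral_add_left hm1.enorm]
          simp only [enorm_mul]
      _ ≤ _ := add_le_add (lintegral_mu_le k fun x => ‖f x‖ₑ) (lintegral_nu_le k fun x => ‖f x‖ₑ)
      _ = ENNReal.ofReal ((1 / 2) ^ k) * ∫⁻ x, ‖f x‖ₑ ∂leb := by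
          -- Removing the common endpoint from the left interval makes the union disjoint.
          rw [← mul_add, setLIntegral_congr Ico_ae_eq_Icc.symm, ← lintegral_union measurableSet_Icc,
            Ico_union_Icc_eq_Icc hc0 hc1]
          exact Set.disjoint_left.2 fun x hx hx' => absurd hx.2 (not_lt.2 hx'.1)
  rw [Lp.norm_def, Lp.norm_def, ← ENNReal.toReal_ofReal (by positivity : (0 : ℝ) ≤ (1 / 2) ^ k),
    ← ENNReal.toReal_mul]
  exact ENNReal.toReal_mono
    (ENNReal.mul_lt_top ENNReal.ofReal_lt_top (Lp.eLpNorm_lt_top f)).ne key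

lemma hasSum_half_pow_succ : HasSum (fun k : ℕ => (1 / 2 : ℝ) ^ (k + 1)) 1 := by
  simpa [pow_succ, div_eq_mul_inv, mul_comm] using hasSum_geometric_two' (1 : ℝ)

lemma summable_norm_B2TermL1_apply (f : L1) : Summable fun k : ℕ => ‖B2TermL1 (k + 1) f‖ :=
  Summable.of_nonneg_of_le (fun _ => norm_nonneg _) (fun k => norm_B2TermL1_apply_le (k + 1) f)
    (hasSum_half_pow_succ.summable.mul_right _)

lemma hasSum_B2TermL1_apply (f : L1) : HasSum (fun k : ℕ => B2TermL1 (k + 1) f) (B2 f) :=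
  summable_B2TermL1.hasSum.mapL (ContinuousLinearMap.apply ℝ L1 f)

lemma norm_B2_apply_le (f : L1) : ‖B2 f‖ ≤ ‖f‖ := by
  rw [← (hasSum_B2TermL1_apply f).tsum_eq]
  refine tsum_of_norm_bounded (g := fun k : ℕ => (1 / 2 : ℝ) ^ (k + 1) * ‖f‖) ?_
    fun k => norm_B2TermL1_apply_le (k + 1) f
  simpa using hasSum_half_pow_succ.mul_right ‖f‖

/-- Summable L¹ norms force pointwise convergence almost everywhere; the countably many choices of
representatives agree off one null set. -/
lemma ae_hasSum_B2Term (f : L1) :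
    ∀ᵐ x ∂leb, HasSum (fun k : ℕ => B2Term (k + 1) f x) (B2 f x) := by
  have hs : ∑' k : ℕ, ‖B2TermL1 (k + 1) f‖ₑ ≠ ∞ := by
    simp_rw [← ofReal_norm]
    exact (summable_norm_B2TermL1_apply f).tsum_ofReal_ne_top
  filter_upwards [Lp.hasSum_coeFn_tsum hs, ae_all_iff.2 fun k : ℕ => B2TermL1_coeFn (k + 1) f]
    with x h1 h2
  rw [(hasSum_B2TermL1_apply f).tsum_eq] at h1
  simpa only [h2] using h1

/-! ### Integral representations -/

lemma L1.intervalIntegrable (g : L1) {a b : ℝ} (ha : a ∈ Icc (0 : ℝ) 1) (hb : b ∈ Icc (0 : ℝ) 1) :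
    IntervalIntegrable g volume a b := by
  have h : IntegrableOn g (Icc 0 1) volume := L1.integrable_coeFn g
  exact (h.mono_set ((convex_Icc (0 : ℝ) 1).ordConnected.uIcc_subset ha hb)).intervalIntegrable

/-- By Lebesgue differentiation, only the integral identity ever needs checking. -/
lemma hasL1Deriv_of_integral {h : C(unitInterval, ℝ)} {g : L1}
    (hg : ∀ x : unitInterval, h x = h 0 + ∫ t in (0 : ℝ)..x, g t) : HasL1Deriv h g := by
  refine ⟨?_, hg⟩
  have hi := L1.intervalIntegrable g (left_mem_Icc.2 zero_le_one) (right_mem_Icc.2 zero_le_one)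
  -- The endpoints are discarded because the constant extension of `h` matches the primitive only
  -- inside `[0,1]`.
  have h0 : ∀ᵐ x : ℝ ∂volume, x ≠ 0 := by simp [ae_iff]
  have h1 : ∀ᵐ x : ℝ ∂volume, x ≠ 1 := by simp [ae_iff]
  refine (ae_restrict_iff' measurableSet_Icc).2 ?_
  filter_upwards [hi.ae_hasDerivAt_integral, h0, h1] with x hx hx0 hx1 hxI
  rw [uIcc_of_le zero_le_one] at hx
  have hd := (hx hxI 0 (left_mem_Icc.2 zero_le_one)).const_add (h 0)
  refine hd.congr_of_eventuallyEq ?_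
  filter_upwards [Ioo_mem_nhds (hxI.1.lt_of_ne' hx0) (hxI.2.lt_of_ne hx1)] with y hy
  rw [IccExtend_of_mem _ _ (Ioo_subset_Icc_self hy)]
  exact hg ⟨y, Ioo_subset_Icc_self hy⟩

lemma integral_sub_eq {h : C(unitInterval, ℝ)} {g : L1}
    (hg : ∀ x : unitInterval, h x = h 0 + ∫ t in (0 : ℝ)..x, g t) (x y : unitInterval) :
    ∫ t in (x : ℝ)..y, g t = h y - h x := by
  rw [hg x, hg y, ← intervalIntegral.integral_interval_sub_left
    (L1.intervalIntegrable g (left_mem_Icc.2 zero_le_one) y.2)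
    (L1.intervalIntegrable g (left_mem_Icc.2 zero_le_one) x.2)]
  ring

lemma Ioo_min_max_subset_Ici {x : ℝ} (hx : 0 ≤ x) : Ioo (min 0 x) (max 0 x) ⊆ Ici 0 := by
  rw [min_eq_left hx]
  exact fun y hy => hy.1.le

lemma integral_B2Term {h : C(unitInterval, ℝ)} {g : L1}
    (hg : ∀ x : unitInterval, h x = h 0 + ∫ t in (0 : ℝ)..x, g t) (k : ℕ) (x : unitInterval) :
    ∫ t in (0 : ℝ)..x, B2Term k g t =
      (1 / 2) ^ k * (h (mu k x) - h (nu k x)) - (1 / 2) ^ k * (h (mu k 0) - h (nu k 0)) := by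
  have hx := x.2.1
  have hsub := Ioo_min_max_subset_Ici hx
  have hu : uIcc (0 : ℝ) x ⊆ Ici 0 := by
    rw [uIcc_of_le hx]; exact fun y hy => hy.1
  have c1 : ContinuousOn (fun y : ℝ => y / (y + 2 ^ k)) (uIcc 0 x) := fun y hy =>
    (hasDerivAt_mu k (hu hy)).continuousAt.continuousWithinAt
  have c2 : ContinuousOn (fun y : ℝ => 1 / (1 + 2 ^ k * y)) (uIcc 0 x) := fun y hy =>
    (hasDerivAt_nu k (hu hy)).continuousAt.continuousWithinAt
  have d1 : ∀ y ∈ Ioo (min 0 (x : ℝ)) (max 0 x), 0 ≤ 2 ^ k / (y + 2 ^ k) ^ 2 :=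
    fun y _ => by positivity
  have d2 : ∀ y ∈ Ioo (min 0 (x : ℝ)) (max 0 x), -(2 ^ k / (1 + 2 ^ k * y) ^ 2) ≤ 0 :=
    fun y _ => neg_nonpos.2 (by positivity)
  -- Monotonicity of the branches allows substitution without continuity of `g`.
  have i1 := intervalIntegral.integral_comp_mul_deriv_of_deriv_nonneg (g := g) c1
    (fun y hy => hasDerivAt_mu k (hsub hy)) d1
  have i2 := intervalIntegral.integral_comp_mul_deriv_of_deriv_nonpos (g := g) c2
    (fun y hy => hasDerivAt_nu k (hsub hy)) d2
  have j1 := (intervalIntegral.integrable_comp_mul_deriv_iff_of_deriv_nonneg (g := g) c1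
    (fun y hy => hasDerivAt_mu k (hsub hy)) d1).2
    (L1.intervalIntegrable g (mu k 0).2 (mu k x).2)
  have j2 := (intervalIntegral.integrable_comp_mul_deriv_iff_of_deriv_nonpos (g := g) c2
    (fun y hy => hasDerivAt_nu k (hsub hy)) d2).2
    (L1.intervalIntegrable g (nu k 0).2 (nu k x).2)
  have e1 := i1.trans (integral_sub_eq hg (mu k 0) (mu k x))
  have e2 := i2.trans (integral_sub_eq hg (nu k 0) (nu k x))
  -- The second branch is decreasing, which produces the minus sign in `F`.
  have hB : ∀ t, B2Term k g t =
      (1 / 2) ^ k * ((g ∘ fun y : ℝ => y / (y + 2 ^ k)) t * (2 ^ k / (t + 2 ^ k) ^ 2)) -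
      (1 / 2) ^ k * ((g ∘ fun y : ℝ => 1 / (1 + 2 ^ k * y)) t *
        -(2 ^ k / (1 + 2 ^ k * t) ^ 2)) := by
    intro t
    have h2 : (1 / 2 : ℝ) ^ k * 2 ^ k = 1 := by rw [← mul_pow]; norm_num
    simp only [B2Term, Function.comp_apply, inv_pow, div_eq_mul_inv, one_mul] at h2 ⊢
    linear_combination (-(((t + 2 ^ k) ^ 2)⁻¹ * g (t * (t + 2 ^ k)⁻¹)) -
      ((1 + 2 ^ k * t) ^ 2)⁻¹ * g (1 + 2 ^ k * t)⁻¹) * h2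
  simp_rw [hB]
  rw [intervalIntegral.integral_sub (j1.const_mul _) (j2.const_mul _),
    intervalIntegral.integral_const_mul, intervalIntegral.integral_const_mul, e1, e2]
  ring

lemma hasSum_F (h : C(unitInterval, ℝ)) (x : unitInterval) :
    HasSum (fun k : ℕ => (1 / 2 : ℝ) ^ (k + 1) * (h (mu (k + 1) x) - h (nu (k + 1) x)))
      (F h x) := by
  refine (Summable.of_norm_bounded (g := fun k : ℕ => (1 / 2 : ℝ) ^ (k + 1) * (‖h‖ + ‖h‖))
    (hasSum_half_pow_succ.summable.mul_right _) fun k => ?_).hasSum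
  rw [norm_mul, Real.norm_of_nonneg (by positivity)]
  gcongr
  exact (norm_sub_le _ _).trans (add_le_add (h.norm_coe_le_norm _) (h.norm_coe_le_norm _))

lemma leb_restrict_Ioc (x : unitInterval) :
    leb.restrict (Ioc 0 (x : ℝ)) = volume.restrict (Ioc 0 (x : ℝ)) :=
  Measure.restrict_restrict_of_subset fun _ hy => ⟨hy.1.le, hy.2.trans x.2.2⟩

/-- Integration over `[0,x]` as an additive map on `L¹([0,1])`. -/
noncomputable def primitiveHom (x : unitInterval) : L1 →+ ℝ where
  toFun f := ∫ t in Ioc 0 (x : ℝ), f t ∂leb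
  map_zero' := by
    rw [setIntegral_congr_ae measurableSet_Ioc
      ((Lp.coeFn_zero ℝ 1 leb).mono fun t ht _ => ht)]
    simp
  map_add' f g := by
    rw [← integral_add (L1.integrable_coeFn f).integrableOn (L1.integrable_coeFn g).integrableOn]
    exact setIntegral_congr_ae measurableSet_Ioc ((Lp.coeFn_add f g).mono fun t ht _ => ht)

lemma primitiveHom_apply (x : unitInterval) (f : L1) :
    primitiveHom x f = ∫ t in (0 : ℝ)..x, f t := by
  rw [intervalIntegral.integral_of_le x.2.1, ← leb_restrict_Ioc]
  rfl

lemma hasSum_integral_B2Term (g : L1) (x : unitInterval) :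
    HasSum (fun k : ℕ => ∫ t in (0 : ℝ)..x, B2Term (k + 1) g t)
      (∫ t in (0 : ℝ)..x, B2 g t) := by
  have h := (hasSum_B2TermL1_apply g).map (primitiveHom x) (continuous_setIntegral _)
  rw [primitiveHom_apply] at h
  refine h.congr_fun fun k => ?_
  rw [intervalIntegral.integral_of_le x.2.1, ← leb_restrict_Ioc]
  exact setIntegral_congr_ae measurableSet_Ioc
    ((B2TermL1_coeFn (k + 1) g).mono fun t ht _ => ht.symm)

lemma HasL1Deriv.F {h : C(unitInterval, ℝ)} {g : L1} (hg : HasL1Deriv h g) :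
    HasL1Deriv (F h) (B2 g) := by
  refine hasL1Deriv_of_integral fun x => ?_
  have h1 := hasSum_integral_B2Term g x
  simp_rw [integral_B2Term hg.2] at h1
  rw [h1.unique ((hasSum_F h x).sub (hasSum_F h 0))]
  ring

/-! ### The class `K₁` -/

/-- Antitone functions whose secant slopes over `[x,y]` are at most those over `[0,x]`
in absolute value. -/
def SlopeControlled (g : C(unitInterval, ℝ)) : Prop :=
  ∀ x y : unitInterval, x ≤ y →
    g y ≤ g x ∧ (x : ℝ) * (g x - g y) ≤ ((y : ℝ) - x) * (g 0 - g x)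

/-- Secants, unlike derivatives, give weak inequalities between point evaluations, which survive
uniform limits. -/
lemma isClosed_slopeControlled : IsClosed {g | SlopeControlled g} := by
  simp only [SlopeControlled, ofPred_forall, ofPred_and]
  refine isClosed_iInter fun x => isClosed_iInter fun y => isClosed_iInter fun _ => ?_
  have hc (z : unitInterval) : Continuous fun g : C(unitInterval, ℝ) => g z :=
    continuous_eval_const z
  have := hc x
  have := hc y
  have := hc 0
  exact (isClosed_le (by fun_prop) (by fun_prop)).inter (isClosed_le (by fun_prop) (by fun_prop))

lemma Moebius.toMap_sub (m : Moebius) (x y : unitInterval) :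
    m.toMap y - m.toMap x =
      m.det * ((y : ℝ) - x) / ((m.c * x + m.d) * (m.c * y + m.d)) := by
  have := m.c_pos
  have := m.d_pos
  have h0 : (0 : ℝ) ≤ x := x.2.1
  have h1 : (0 : ℝ) ≤ y := y.2.1
  have hx : m.c * (x : ℝ) + m.d ≠ 0 := by positivity
  have hy : m.c * (y : ℝ) + m.d ≠ 0 := by positivity
  simp only [Moebius.toMap, Moebius.det, ContinuousMap.coe_mk]
  field_simp
  ring

lemma Moebius.signed_det_neg {m : Moebius} {ε : ℝ} (h : ε * Real.sign m.det < 0) :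
    ε * m.det < 0 := by
  rcases lt_trichotomy m.det 0 with hd | hd | hd
  · rw [Real.sign_of_neg hd] at h
    nlinarith
  · simp [hd] at h
  · rw [Real.sign_of_pos hd] at h
    nlinarith

/-- With `D = -ε * m.det > 0`, the absolute secant slopes are `D/((cx+d)(cy+d))` over `[x,y]` and
`D/(d(cx+d))` over `[0,x]`, and `d ≤ cy+d`. -/
lemma Moebius.slope_bounds {m : Moebius} {ε : ℝ} (h : ε * Real.sign m.det < 0)
    {x y : unitInterval} (hxy : x ≤ y) :
    ε * m.toMap y ≤ ε * m.toMap x ∧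
    (x : ℝ) * (ε * m.toMap x - ε * m.toMap y) ≤
      ((y : ℝ) - x) * (ε * m.toMap 0 - ε * m.toMap x) := by
  have hD := signed_det_neg h
  have hc := m.c_pos
  have hd := m.d_pos
  have h0 : (0 : ℝ) ≤ x := x.2.1
  have h1 : (0 : ℝ) ≤ y := y.2.1
  have hsub : (0 : ℝ) ≤ (y : ℝ) - x := sub_nonneg.2 hxy
  have e1 : ε * m.toMap x - ε * m.toMap y =
      -(ε * m.det) * ((y : ℝ) - x) / ((m.c * x + m.d) * (m.c * y + m.d)) := by
    linear_combination (-ε) * m.toMap_sub x y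
  have e2 : ε * m.toMap 0 - ε * m.toMap x =
      -(ε * m.det) * (x : ℝ) / (m.d * (m.c * x + m.d)) := by
    have := m.toMap_sub 0 x
    simp only [Icc.coe_zero, mul_zero, zero_add, sub_zero] at this
    linear_combination (-ε) * this
  have hD' : 0 < -(ε * m.det) := by linarith
  constructor
  · rw [← sub_nonneg, e1]
    positivity
  · rw [e1, e2, ← mul_div_assoc, ← mul_div_assoc, mul_comm (m.c * (x : ℝ) + m.d)]
    have : (x : ℝ) * (-(ε * m.det) * ((y : ℝ) - x)) = ((y : ℝ) - x) * (-(ε * m.det) * x) := by ring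
    rw [this]
    gcongr
    nlinarith

lemma slopeControlled_of_mem_S {g : C(unitInterval, ℝ)} (hg : g ∈ S) : SlopeControlled g := by
  obtain ⟨ε, m, -, hε, -, -, hs⟩ := hg
  intro x y hxy
  exact ⟨hasSum_le (fun i => (Moebius.slope_bounds (hε i) hxy).1) (hs y) (hs x),
    hasSum_le (fun i => (Moebius.slope_bounds (hε i) hxy).2)
      (((hs x).sub (hs y)).mul_left _) (((hs 0).sub (hs x)).mul_left _)⟩

lemma slopeControlled_of_mem_K1 {h : C(unitInterval, ℝ)} (hh : h ∈ K1) : SlopeControlled h :=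
  closure_minimal (fun _ => slopeControlled_of_mem_S) isClosed_slopeControlled hh.1

/-- For `δ ≤ x < y` the absolute slope over `[x,y]` is at most `(h 0 - h x)/x`, hence at most `(h 0
- h 1)/δ`. -/
lemma SlopeControlled.lipschitzOnWith {h : C(unitInterval, ℝ)} (hh : SlopeControlled h) {δ : ℝ}
    (hδ : 0 < δ) :
    LipschitzOnWith ((h 0 - h 1) / δ).toNNReal (IccExtend (zero_le_one' ℝ) h) (Icc δ 1) := by
  refine LipschitzOnWith.of_le_add_mul _ fun x hx y hy => ?_
  have hx' : x ∈ Icc (0 : ℝ) 1 := ⟨hδ.le.trans hx.1, hx.2⟩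
  have hy' : y ∈ Icc (0 : ℝ) 1 := ⟨hδ.le.trans hy.1, hy.2⟩
  have h01 := (hh 0 1 zero_le_one).1
  rw [IccExtend_of_mem _ _ hx', IccExtend_of_mem _ _ hy', Real.dist_eq,
    Real.coe_toNNReal _ (div_nonneg (by linarith) hδ.le)]
  set X : unitInterval := ⟨x, hx'⟩
  set Y : unitInterval := ⟨y, hy'⟩
  rcases le_total x y with hxy | hxy
  · obtain ⟨h1, h2⟩ := hh X Y hxy
    have h3 := (hh X 1 hx.2).1
    have h4 : δ * (h X - h Y) ≤ (y - x) * (h 0 - h 1) := by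
      calc δ * (h X - h Y) ≤ x * (h X - h Y) :=
            mul_le_mul_of_nonneg_right hx.1 (sub_nonneg.2 h1)
        _ ≤ (y - x) * (h 0 - h X) := h2
        _ ≤ (y - x) * (h 0 - h 1) :=
            mul_le_mul_of_nonneg_left (by linarith) (sub_nonneg.2 hxy)
    rw [abs_of_nonpos (by linarith), ← sub_le_iff_le_add', div_mul_eq_mul_div, le_div_iff₀ hδ]
    linarith
  · have h1 := (hh Y X hxy).1
    have : 0 ≤ (h 0 - h 1) / δ * |x - y| :=
      mul_nonneg (div_nonneg (by linarith) hδ.le) (abs_nonneg _)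
    linarith

lemma SlopeControlled.exists_hasL1Deriv {h : C(unitInterval, ℝ)} (hh : SlopeControlled h) :
    ∃ g : L1, HasL1Deriv h g := by
  set H : ℝ → ℝ := IccExtend (zero_le_one' ℝ) h with hH
  have hHc : Continuous H := h.continuous.Icc_extend'
  have hmono : Monotone (-H) := fun x y hxy =>
    neg_le_neg (hh _ _ (monotone_projIcc (zero_le_one' ℝ) hxy)).1
  -- Near `0` the Lipschitz bound is lost; integrability comes from monotonicity instead.
  have hint : IntervalIntegrable (deriv H) volume 0 1 := by
    have := ((hmono.monotoneOn (uIcc (0 : ℝ) 1)).intervalIntegrable_deriv).neg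
    rwa [show -deriv (-H) = deriv H by ext x; simp] at this
  have hI : Integrable (deriv H) leb :=
    (intervalIntegrable_iff_integrableOn_Icc_of_le zero_le_one).1 hint
  have hftc : ∀ x ∈ Icc (0 : ℝ) 1, ∀ a ∈ Ioc 0 x, ∫ t in a..x, deriv H t = H x - H a := by
    intro x hx a ha
    refine AbsolutelyContinuousOnInterval.integral_deriv_eq_sub
      (LipschitzOnWith.absolutelyContinuousOnInterval
        ((hh.lipschitzOnWith ha.1).mono ?_))
    rw [uIcc_of_le ha.2]
    exact Icc_subset_Icc_right hx.2
  have hzero : ∀ x ∈ Icc (0 : ℝ) 1, ∫ t in (0 : ℝ)..x, deriv H t = H x - H 0 := by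
    intro x hx
    rcases hx.1.eq_or_lt with rfl | hx0
    · simp
    -- Both sides are continuous in the lower limit `a` and agree for `a > 0`, so they agree at `a =
    -- 0`.
    have hc : ContinuousOn (fun a => ∫ t in a..x, deriv H t) (Icc 0 x) := by
      have := intervalIntegral.continuousOn_primitive_interval_left (f := deriv H) (μ := volume)
        (a := 0) (b := x) (IntegrableOn.mono_set (t := Icc 0 1) hI ?_)
      · rwa [uIcc_of_le hx.1] at this
      · rw [uIcc_of_le hx.1]
        exact Icc_subset_Icc_right hx.2
    have hc' : ContinuousOn (fun a => H x - H a) (Icc 0 x) := by fun_prop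
    have heq : EqOn (fun a => ∫ t in a..x, deriv H t) (fun a => H x - H a) (Ioc 0 x) :=
      fun a ha => hftc x hx a ha
    refine heq.of_subset_closure hc hc' Ioc_subset_Icc_self ?_ (left_mem_Icc.2 hx.1)
    rw [closure_Ioc hx0.ne]
  refine ⟨hI.toL1 _, hasL1Deriv_of_integral fun x => ?_⟩
  have h1 : ∫ t in (0 : ℝ)..x, hI.toL1 _ t = ∫ t in (0 : ℝ)..x, deriv H t := by
    rw [intervalIntegral.integral_of_le x.2.1, intervalIntegral.integral_of_le x.2.1,
      ← leb_restrict_Ioc]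
    exact setIntegral_congr_ae measurableSet_Ioc (hI.coeFn_toL1.mono fun t ht _ => ht)
  rw [h1, hzero x x.2, hH, IccExtend_of_mem _ _ x.2,
    IccExtend_of_mem _ _ (left_mem_Icc.2 zero_le_one)]
  change h x = h 0 + (h x - h 0)
  ring

end BinaryEuclid

theorem mainTheorem3 :
    (∀ f : BinaryEuclid.L1, ∀ᵐ x ∂BinaryEuclid.leb,
      HasSum (fun k : ℕ => BinaryEuclid.B2Term (k + 1) f x) (BinaryEuclid.B2 f x)) ∧
    (∀ f : BinaryEuclid.L1, ‖BinaryEuclid.B2 f‖ ≤ ‖f‖) ∧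
    ∀ h ∈ BinaryEuclid.K1, ∃ h' : BinaryEuclid.L1,
      BinaryEuclid.HasL1Deriv h h' ∧
      BinaryEuclid.HasL1Deriv (BinaryEuclid.F h) (BinaryEuclid.B2 h') := by
  refine ⟨BinaryEuclid.ae_hasSum_B2Term, BinaryEuclid.norm_B2_apply_le, fun h hh => ?_⟩
  obtain ⟨g, hg⟩ := (BinaryEuclid.slopeControlled_of_mem_K1 hh).exists_hasL1Deriv
  exact ⟨g, hg, hg.F⟩
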